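/- A tournament is a finite, nonempty, loopless directed graph in which every two distinct vertices are joined by exactly one arc. A closed directed walk (possibly consisting of a single vertex, and then of length $0$) in a tournament $T$ is called dominating if every vertex of $T$ lies on the walk or is the head of an arc whose tail lies on the walk. The watchman number $w(T)$ is the minimum length (number of arcs, counted with repetition) of a closed dominating walk in $T$, with $w(T)=\infty$ if there is none. Let $T$ be a tournament on $n\ge 1$ vertices. If $n<7$, then $w(T)\le 3$; and if $n<19$, then $w(T)\le 4$. (In particular, $T$ has a closed dominating walk in these cases.) -/

import Mathlib

namespace Digraph

variable {V : Type*}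

/-- `D` is an orientation of the simple graph `G`: every arc of `D` lies on an edge of `G`, and
every edge of `G` carries exactly one of its two possible arcs. -/
structure IsOrientation (D : Digraph V) (G : SimpleGraph V) : Prop where
  adj_of_arc : ∀ u v, D.Adj u v → G.Adj u v
  arc_xor : ∀ u v, G.Adj u v → Xor (D.Adj u v) (D.Adj v u)

/-- A tournament is an orientation of a complete graph. -/
def IsTournament (D : Digraph V) : Prop :=
  D.IsOrientation (⊤ : SimpleGraph V)

/-- Every vertex of `D` lies in `S` or is an out-neighbour of a vertex of `S`. -/
def IsDominatingSet (D : Digraph V) (S : Set V) : Prop :=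
  ∀ v, v ∈ S ∨ ∃ u ∈ S, D.Adj u v

/-- Directed walks from `u` to `v`; vertices and arcs may repeat, and the walk that consists of
a single vertex (of length `0`) is allowed. -/
inductive Walk (D : Digraph V) : V → V → Type _
  | nil (u : V) : Walk D u u
  | cons {u v w : V} (h : D.Adj u v) (p : Walk D v w) : Walk D u w

namespace Walk

variable {D : Digraph V}

/-- The number of arcs of a walk, counted with repetition. -/
def length : {u v : V} → D.Walk u v → ℕ
  | _, _, nil _ => 0
  | _, _, cons _ p => p.length + 1

/-- The vertices visited by a walk, in order. -/
def support : {u v : V} → D.Walk u v → List V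
  | _, _, nil u => [u]
  | u, _, cons _ p => u :: p.support

/-- The vertices of the walk form a dominating set. -/
def IsDominating {u v : V} (p : D.Walk u v) : Prop :=
  D.IsDominatingSet {x | x ∈ p.support}

end Walk

/-- The watchman number `w(D)`: the minimum length of a closed dominating walk of `D`
(and `⊤` if `D` has no closed dominating walk). -/
noncomputable def watchmanNumber (D : Digraph V) : ℕ∞ :=
  ⨅ (v : V) (p : D.Walk v v) (_ : p.IsDominating), (p.length : ℕ∞)

end Digraph

namespace Digraph

variable {V : Type*} {T : Digraph V}

namespace IsTournament

/-! Suppose no `k` vertices dominate. Then fewer than `k` vertices always have more than `k` common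
in-neighbours, and averaging in-degrees turns a bound `d` for `insert w P` into `2 * d + 1` for `P`.
This gives 3, 7 for `k = 2` and 4, 9, 19 for `k = 3`. So small tournaments have dominating pairs or
triples, and a vertex witnessing that a smaller set fails to dominate closes these into a 3-cycle or
a 4-cycle. -/

theorem irrefl (hT : T.IsTournament) (u : V) : ¬ T.Adj u u := fun h =>
  (hT.adj_of_arc u u h).ne rfl

theorem asymm (hT : T.IsTournament) {u v : V} (h : T.Adj u v) : ¬ T.Adj v u := by
  rcases hT.arc_xor u v (hT.adj_of_arc u v h) with h' | h'
  · exact h'.2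
  · exact absurd h h'.2

theorem total (hT : T.IsTournament) {u v : V} (h : u ≠ v) : T.Adj u v ∨ T.Adj v u :=
  (hT.arc_xor u v h).imp And.left And.left

/-- A set that is not dominating has a common in-neighbour. -/
theorem exists_forall_adj (hT : T.IsTournament) {S : Set V} (hS : ¬ T.IsDominatingSet S) :
    ∃ x, ∀ y ∈ S, T.Adj x y := by
  simp only [IsDominatingSet, not_forall, not_or, not_exists, not_and] at hS
  obtain ⟨x, hx, h⟩ := hS
  exact ⟨x, fun y hy => (hT.total fun e => hx (by rwa [e])).resolve_right (h y hy)⟩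

open Classical in
/-- A nonempty set of vertices of a tournament in which all in-degrees are at least `d` has at
least `2 * d + 1` elements. -/
theorem two_mul_add_one_le_card (hT : T.IsTournament) {s : Finset V} (hs : s.Nonempty) {d : ℕ}
    (hd : ∀ w ∈ s, d ≤ (s.filter fun x => T.Adj x w).card) : 2 * d + 1 ≤ s.card := by
  have hdeg : ∀ w ∈ s,
      (s.filter fun x => T.Adj x w).card + (s.filter fun x => T.Adj w x).card + 1 = s.card := by
    intro w hw
    rw [← Finset.card_union_of_disjoint, ← Finset.card_erase_add_one hw]
    · congr 2
      ext x
      simp only [Finset.mem_union, Finset.mem_filter, Finset.mem_erase]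
      constructor
      · rintro (⟨hx, h⟩ | ⟨hx, h⟩)
        · exact ⟨(hT.adj_of_arc _ _ h).ne, hx⟩
        · exact ⟨(hT.adj_of_arc _ _ h).ne', hx⟩
      · rintro ⟨hne, hx⟩
        exact (hT.total hne).imp (⟨hx, ·⟩) (⟨hx, ·⟩)
    · rw [Finset.disjoint_filter]
      exact fun x _ h => hT.asymm h
  have hcount : ∑ w ∈ s, (s.filter fun x => T.Adj w x).card =
      ∑ w ∈ s, (s.filter fun x => T.Adj x w).card :=
    Finset.sum_card_bipartiteAbove_eq_sum_card_bipartiteBelow T.Adj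
  have hsum := Finset.sum_congr rfl hdeg
  have hle := Finset.sum_le_sum hd
  simp only [Finset.sum_add_distrib, hcount, Finset.sum_const, smul_eq_mul, mul_one] at hsum hle
  refine Nat.le_of_mul_le_mul_left ?_ hs.card_pos
  linarith

end IsTournament

section CommonInNeighbors

variable [Fintype V]

open Classical in
/-- The vertices that have an arc to every vertex of `P`. -/
noncomputable def commonInNeighbors (T : Digraph V) (P : Finset V) : Finset V :=
  Finset.univ.filter fun x => ∀ y ∈ P, T.Adj x y

theorem mem_commonInNeighbors {P : Finset V} {x : V} :
    x ∈ T.commonInNeighbors P ↔ ∀ y ∈ P, T.Adj x y := by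
  simp [commonInNeighbors]

open Classical in
/-- If no set of at most `k` vertices is dominating, then any set of fewer than `k` vertices has
more than `k` common in-neighbours. -/
theorem IsTournament.lt_card_commonInNeighbors (hT : T.IsTournament) {k : ℕ}
    (hk : ∀ S : Finset V, S.card ≤ k → ¬ T.IsDominatingSet (S : Set V)) {P : Finset V}
    (hP : P.card < k) : k < (T.commonInNeighbors P).card := by
  by_contra! hle
  -- `x` beats every common in-neighbour of `P`, while `y`, beating `P` and `x`, is one of them.
  obtain ⟨x, hx⟩ := hT.exists_forall_adj (hk _ hle)
  obtain ⟨y, hy⟩ := hT.exists_forall_adj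
    (hk (insert x P) ((Finset.card_insert_le _ _).trans hP))
  have hyP : y ∈ T.commonInNeighbors P :=
    mem_commonInNeighbors.2 fun z hz => hy z (by simp [hz])
  exact hT.asymm (hx y hyP) (hy x (by simp))

open Classical in
-- Inside the common in-neighbourhood of `P`, the in-neighbours of `w` are the common in-neighbours
-- of `insert w P`.
theorem IsTournament.two_mul_add_one_le_card_commonInNeighbors (hT : T.IsTournament)
    {P : Finset V} {d : ℕ} (hP : (T.commonInNeighbors P).Nonempty)
    (hd : ∀ w, d ≤ (T.commonInNeighbors (insert w P)).card) :
    2 * d + 1 ≤ (T.commonInNeighbors P).card := by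
  refine hT.two_mul_add_one_le_card hP fun w _ => (hd w).trans (Finset.card_le_card ?_)
  intro x hx
  simp only [mem_commonInNeighbors, Finset.mem_insert, forall_eq_or_imp, Finset.mem_filter]
    at hx ⊢
  exact ⟨hx.2, hx.1⟩

/-- A tournament in which no two vertices form a dominating set has at least `7` vertices. -/
theorem IsTournament.seven_le_card (hT : T.IsTournament)
    (h : ∀ S : Finset V, S.card ≤ 2 → ¬ T.IsDominatingSet (S : Set V)) :
    7 ≤ Fintype.card V := by
  classical
  have h0 := hT.lt_card_commonInNeighbors h (P := ∅) (by simp)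
  refine (hT.two_mul_add_one_le_card_commonInNeighbors (P := ∅) (d := 3)
    (Finset.card_pos.1 (by lia)) fun w => hT.lt_card_commonInNeighbors h ?_).trans
    (Finset.card_le_univ _)
  simp

/-- A tournament in which no three vertices form a dominating set has at least `19` vertices. -/
theorem IsTournament.nineteen_le_card (hT : T.IsTournament)
    (h : ∀ S : Finset V, S.card ≤ 3 → ¬ T.IsDominatingSet (S : Set V)) :
    19 ≤ Fintype.card V := by
  classical
  have h0 := hT.lt_card_commonInNeighbors h (P := ∅) (by simp)
  refine (hT.two_mul_add_one_le_card_commonInNeighbors (P := ∅) (d := 9)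
    (Finset.card_pos.1 (by lia)) fun w => ?_).trans (Finset.card_le_univ _)
  have h1 := hT.lt_card_commonInNeighbors h (P := insert w ∅) (by simp)
  -- Two averaging steps: `9 = 2 * 4 + 1` and `19 = 2 * 9 + 1`.
  refine hT.two_mul_add_one_le_card_commonInNeighbors (d := 4)
    (Finset.card_pos.1 (by lia)) fun v => hT.lt_card_commonInNeighbors h ?_
  exact (Finset.card_insert_le _ _).trans_lt (by simp)

end CommonInNeighbors

theorem IsDominatingSet.mono {S S' : Set V} (h : T.IsDominatingSet S) (hS : S ⊆ S') :
    T.IsDominatingSet S' := fun v =>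
  (h v).imp (@hS v) fun ⟨u, hu, huv⟩ => ⟨u, hS hu, huv⟩

theorem Walk.IsDominating.watchmanNumber_le {v : V} {p : T.Walk v v} (hp : p.IsDominating) :
    T.watchmanNumber ≤ p.length :=
  iInf₂_le_of_le v p (iInf_le _ hp)

theorem watchmanNumber_le_zero {u : V} (h : T.IsDominatingSet {u}) : T.watchmanNumber ≤ 0 :=
  Walk.IsDominating.watchmanNumber_le (p := Walk.nil u) (h.mono (by simp [Walk.support]))

theorem watchmanNumber_le_three {a b c : V} (hab : T.Adj a b) (hbc : T.Adj b c)
    (hca : T.Adj c a) (h : T.IsDominatingSet {a, b, c}) : T.watchmanNumber ≤ 3 :=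
  Walk.IsDominating.watchmanNumber_le (p := .cons hab (.cons hbc (.cons hca (.nil a))))
    (h.mono (by intro x; simp [Walk.support]; tauto))

theorem watchmanNumber_le_four {a b c d : V} (hab : T.Adj a b) (hbc : T.Adj b c)
    (hcd : T.Adj c d) (hda : T.Adj d a) (h : T.IsDominatingSet {a, b, c, d}) :
    T.watchmanNumber ≤ 4 :=
  Walk.IsDominating.watchmanNumber_le
    (p := .cons hab (.cons hbc (.cons hcd (.cons hda (.nil a)))))
    (h.mono (by intro x; simp [Walk.support]; tauto))

namespace IsTournament

/-- If `u` alone fails, some `x` beats `u`; only `v` can dominate `x`, so `u, v, x` is a directed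
triangle. -/
theorem watchmanNumber_le_three_of_adj (hT : T.IsTournament) {u v : V} (huv : T.Adj u v)
    (h : T.IsDominatingSet {u, v}) : T.watchmanNumber ≤ 3 := by
  by_cases hu : T.IsDominatingSet {u}
  · exact (watchmanNumber_le_zero hu).trans (by simp)
  obtain ⟨x, hx⟩ := hT.exists_forall_adj hu
  have hxu : T.Adj x u := hx u rfl
  have hvx : T.Adj v x := by
    rcases h x with (rfl | rfl) | ⟨y, rfl | rfl, hy⟩
    · exact absurd hxu (hT.irrefl _)
    · exact absurd hxu (hT.asymm huv)
    · exact absurd hxu (hT.asymm hy)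
    · exact hy
  exact watchmanNumber_le_three huv hvx hxu (h.mono (by intro y; simp; tauto))

theorem watchmanNumber_le_three_of_pair (hT : T.IsTournament) {u v : V}
    (h : T.IsDominatingSet {u, v}) : T.watchmanNumber ≤ 3 := by
  rcases eq_or_ne u v with rfl | hne
  · exact (watchmanNumber_le_zero (u := u) (h.mono (by simp))).trans (by simp)
  rcases hT.total hne with huv | hvu
  · exact hT.watchmanNumber_le_three_of_adj huv h
  · exact hT.watchmanNumber_le_three_of_adj hvu (h.mono (Set.pair_comm u v).subset)

/-- If `a, b` fail, a vertex `x` beating both must be beaten by `c`, closing the path through `x`.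
-/
theorem watchmanNumber_le_four_of_adj (hT : T.IsTournament) {a b c : V} (hab : T.Adj a b)
    (hbc : T.Adj b c) (h : T.IsDominatingSet {a, b, c}) : T.watchmanNumber ≤ 4 := by
  by_cases h2 : T.IsDominatingSet {a, b}
  · exact (hT.watchmanNumber_le_three_of_pair h2).trans (by norm_num)
  obtain ⟨x, hx⟩ := hT.exists_forall_adj h2
  have hxa : T.Adj x a := hx a (by simp)
  have hxb : T.Adj x b := hx b (by simp)
  rcases h x with (rfl | rfl | rfl) | ⟨y, rfl | rfl | rfl, hy⟩
  · exact absurd hxa (hT.irrefl _)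
  · exact absurd hxb (hT.irrefl _)
  · exact absurd hxb (hT.asymm hbc)
  · exact absurd hxa (hT.asymm hy)
  · exact absurd hxb (hT.asymm hy)
  · exact watchmanNumber_le_four hab hbc hy hxa (h.mono (by intro z; simp; tauto))

/-- Three distinct vertices of a tournament always carry a directed Hamiltonian path. -/
theorem watchmanNumber_le_four_of_triple (hT : T.IsTournament) {a b c : V}
    (h : T.IsDominatingSet {a, b, c}) : T.watchmanNumber ≤ 4 := by
  have pair {u v : V} (h2 : T.IsDominatingSet {u, v}) : T.watchmanNumber ≤ 4 :=
    (hT.watchmanNumber_le_three_of_pair h2).trans (by norm_num)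
  rcases eq_or_ne a b with rfl | hab
  · exact pair (u := a) (v := c) (h.mono (by simp))
  rcases eq_or_ne b c with rfl | hbc
  · exact pair (u := a) (v := b) (h.mono (by simp))
  rcases eq_or_ne a c with rfl | hac
  · exact pair (u := a) (v := b) (h.mono (by intro z; simp; tauto))
  have path {x y z : V} (hxy : T.Adj x y) (hyz : T.Adj y z)
      (hs : ({a, b, c} : Set V) ⊆ {x, y, z}) : T.watchmanNumber ≤ 4 :=
    hT.watchmanNumber_le_four_of_adj hxy hyz (h.mono hs)
  rcases hT.total hab with hab | hba <;> rcases hT.total hbc with hbc | hcb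
  · exact path hab hbc subset_rfl
  · rcases hT.total hac with hac | hca
    · exact path hac hcb (by intro z; simp; tauto)
    · exact path hca hab (by intro z; simp; tauto)
  · rcases hT.total hac with hac | hca
    · exact path hba hac (by intro z; simp; tauto)
    · exact path hbc hca (by intro z; simp; tauto)
  · exact path hcb hba (by intro z; simp; tauto)

end IsTournament

end Digraph

theorem mainTheorem12 {V : Type*} [Fintype V] [Nonempty V] (T : Digraph V)
    (hT : T.IsTournament) :
    (Fintype.card V < 7 → T.watchmanNumber ≤ 3) ∧
      (Fintype.card V < 19 → T.watchmanNumber ≤ 4) := by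
  classical
  -- Lists a small set with possible padding: once it is empty, any vertex serves, since enlarging
  -- keeps domination.
  have remove {S : Finset V} {n : ℕ} (hS : S.card ≤ n + 1) : ∃ a, (S.erase a).card ≤ n := by
    obtain rfl | ⟨a, ha⟩ := S.eq_empty_or_nonempty
    · exact ⟨Classical.arbitrary V, by simp⟩
    · exact ⟨a, by rw [Finset.card_erase_of_mem ha]; lia⟩
  constructor
  · intro hn
    by_contra hw
    refine hn.not_ge (hT.seven_le_card fun S hS hdom => hw ?_)
    obtain ⟨a, ha⟩ := remove hS
    obtain ⟨b, hb⟩ := remove ha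
    refine hT.watchmanNumber_le_three_of_pair (u := a) (v := b) (hdom.mono fun x hx => ?_)
    have := Finset.eq_empty_iff_forall_notMem.1 (Finset.card_eq_zero.1 (Nat.le_zero.1 hb)) x
    simp only [Finset.mem_erase, Finset.mem_coe] at this hx
    simp only [Set.mem_insert_iff, Set.mem_singleton_iff]
    tauto
  · intro hn
    by_contra hw
    refine hn.not_ge (hT.nineteen_le_card fun S hS hdom => hw ?_)
    obtain ⟨a, ha⟩ := remove hS
    obtain ⟨b, hb⟩ := remove ha
    obtain ⟨c, hc⟩ := remove hb
    refine hT.watchmanNumber_le_four_of_triple (a := a) (b := b) (c := c)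
      (hdom.mono fun x hx => ?_)
    have := Finset.eq_empty_iff_forall_notMem.1 (Finset.card_eq_zero.1 (Nat.le_zero.1 hc)) x
    simp only [Finset.mem_erase, Finset.mem_coe] at this hx
    simp only [Set.mem_insert_iff, Set.mem_singleton_iff]
    tauto
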